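/- Let $n\ge 1$ and $\delta>0$, and let $B_n$ be the closed unit ball of $\mathbb{R}^n$. A function $f:\mathbb{R}^n\to[0,\infty)$ is logconcave if $f(sx+(1-s)y)\ge f(x)^s f(y)^{1-s}$ for all $x,y\in\mathbb{R}^n$ and $s\in[0,1]$. For $a>0$, a probability density $f$ on $\mathbb{R}^n$ is $a$-rounded if every level set $L=\{x: f(x)\ge t\}$, $t>0$, contains a ball of radius $a\int_L f$ (balls being open, so that a ball of radius $0$ is empty). For a probability density $f$ with support $K=\{x: f(x)\ne 0\}$, the average local conductance of the ball walk with step radius $\delta$ is $$\lambda(f)=\frac{\int_K \ell(x)f(x)\,dx}{\int_K f(x)\,dx},\qquad \ell(x)=\frac{\mathrm{vol}\big(K\cap(x+\delta B_n)\big)}{\mathrm{vol}(\delta B_n)}.$$ (1) For every $a>0$ and every $a$-rounded logconcave probability density $f$ on $\mathbb{R}^n$, $$\lambda(f)\ \ge\ 1-32\,\frac{\delta^{1/2}n^{1/4}}{a^{1/2}}.$$ (2) Let $0<\sigma\le 1$, let $K\subseteq\mathbb{R}^n$ be a convex set with $B_n\subseteq K$, and let $f$ be the density of the Gaussian $N(0,\sigma^2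 I_n)$ restricted to $K$, that is, the probability density that is proportional to $e^{-\|x\|^2/(2\sigma^2)}$ on $K$ and zero outside $K$. If $\delta\le \sigma/(4096\sqrt n)$, then $\lambda(f)\ge 1/2$. -/

import Mathlib

open MeasureTheory

noncomputable section

/-- `f` is a probability density on `ℝⁿ` with respect to Lebesgue measure. -/
structure IsProbDensity {n : ℕ} (f : EuclideanSpace ℝ (Fin n) → ℝ) : Prop where
  nonneg : ∀ x, 0 ≤ f x
  integrable : Integrable f
  integral_eq_one : ∫ x, f x = 1

/-- A nonnegative function `f` is logconcave if
`f (s x + (1 - s) y) ≥ f x ^ s * f y ^ (1 - s)` for all `x`, `y` and `s ∈ [0, 1]`. -/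
def IsLogConcave {n : ℕ} (f : EuclideanSpace ℝ (Fin n) → ℝ) : Prop :=
  (∀ x, 0 ≤ f x) ∧
    ∀ (x y : EuclideanSpace ℝ (Fin n)) (s : ℝ), 0 ≤ s → s ≤ 1 →
      f x ^ s * f y ^ (1 - s) ≤ f (s • x + (1 - s) • y)

/-- The level set `{x | f x ≥ t}`. -/
def levelSet {n : ℕ} (f : EuclideanSpace ℝ (Fin n) → ℝ) (t : ℝ) :
    Set (EuclideanSpace ℝ (Fin n)) :=
  {x | t ≤ f x}

/-- `f` is `a`-rounded if every level set `L` contains a ball of radius `a * μ_f(L)`, where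
`μ_f` is the measure with density `f`. -/
def IsRounded {n : ℕ} (a : ℝ) (f : EuclideanSpace ℝ (Fin n) → ℝ) : Prop :=
  ∀ t : ℝ, 0 < t → ∃ c : EuclideanSpace ℝ (Fin n),
    Metric.ball c (a * ∫ x in levelSet f t, f x) ⊆ levelSet f t

/-- Local conductance `ℓ(x) = vol(K ∩ (x + δB)) / vol(δB)` of the ball walk in `K` with
radius `δ`. -/
def localConductance {n : ℕ} (K : Set (EuclideanSpace ℝ (Fin n))) (δ : ℝ)
    (x : EuclideanSpace ℝ (Fin n)) : ℝ :=
  volume.real (K ∩ Metric.closedBall x δ) /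
    volume.real (Metric.closedBall (0 : EuclideanSpace ℝ (Fin n)) δ)

/-- Average local conductance `λ(f) = (∫_K ℓ f) / (∫_K f)`, where `K = {f ≠ 0}` is the support
of `f`. -/
def avgLocalConductance {n : ℕ} (δ : ℝ) (f : EuclideanSpace ℝ (Fin n) → ℝ) : ℝ :=
  (∫ x in Function.support f, localConductance (Function.support f) δ x * f x) /
    ∫ x in Function.support f, f x

/-- The density of the Gaussian `N(0, σ² I)` restricted to `K`: proportional to
`exp (-‖x‖² / (2 σ²))` on `K`, zero off `K`, normalized. -/
def restrictedGaussian {n : ℕ} (K : Set (EuclideanSpace ℝ (Fin n))) (σ : ℝ) :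
    EuclideanSpace ℝ (Fin n) → ℝ :=
  K.indicator fun x =>
    Real.exp (-‖x‖ ^ 2 / (2 * σ ^ 2)) / ∫ y in K, Real.exp (-‖y‖ ^ 2 / (2 * σ ^ 2))

end

open scoped ENNReal

/-! ### Escape from a single convex set. -/

section Geometry

variable {n : ℕ}

/-- Points of a convex set that lie in a ball centred off the set lie in a smaller ball. -/
lemma inter_closedBall_subset {E : Type*} [NormedAddCommGroup E] [InnerProductSpace ℝ E]
    {L : Set E} (hL : Convex ℝ L) {y p : E} (hp : p ∈ L)
    (hyp : Metric.infDist y L = dist y p) (δ : ℝ) :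
    L ∩ Metric.closedBall y δ ⊆
      Metric.closedBall p (√(δ ^ 2 - Metric.infDist y L ^ 2)) := by
  rintro x ⟨hx, hxy⟩
  have hinf : ‖y - p‖ = ⨅ w : L, ‖y - w‖ := by
    rw [← dist_eq_norm, ← hyp, Metric.infDist_eq_iInf]
    simp_rw [dist_eq_norm]
  -- The angle at the nearest point `p` is not acute, so `‖x - p‖² + ‖y - p‖² ≤ ‖x - y‖²`.
  have hin := (norm_eq_iInf_iff_real_inner_le_zero hL hp).1 hinf x hx
  rw [Metric.mem_closedBall, dist_eq_norm] at hxy ⊢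
  apply Real.le_sqrt_of_sq_le
  have h1 : ‖x - y‖ ^ 2 = ‖x - p‖ ^ 2 - 2 * inner ℝ (x - p) (y - p) + ‖y - p‖ ^ 2 := by
    rw [← norm_sub_sq_real]; congr 2; abel
  rw [real_inner_comm] at hin
  rw [hyp, dist_eq_norm]
  have h2 : ‖x - y‖ ^ 2 ≤ δ ^ 2 := by gcongr
  linarith

/-- The part of a ball centred at distance `d` from a convex set that lies in the set has
relative volume at most `exp (-n d² / (2 δ²))`. -/
lemma volume_inter_closedBall_le {L : Set (EuclideanSpace ℝ (Fin n))} (hL : Convex ℝ L)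
    (hLc : IsClosed L) (hne : L.Nonempty) {δ : ℝ} (hδ : 0 < δ) (y : EuclideanSpace ℝ (Fin n)) :
    volume (L ∩ Metric.closedBall y δ) ≤
      ENNReal.ofReal (Real.exp (-(√n * Metric.infDist y L / δ) ^ 2 / 2)) *
        volume (Metric.closedBall (0 : EuclideanSpace ℝ (Fin n)) δ) := by
  obtain ⟨p, hp, hyp⟩ := hLc.exists_infDist_eq_dist hne y
  set d := Metric.infDist y L with hd
  -- This is `1 - u ≤ exp (-u)` at `u = (d / δ)²`; for `d > δ` the root is `0` by default.
  have hrad : √(δ ^ 2 - d ^ 2) ≤ Real.exp (-(d / δ) ^ 2 / 2) * δ := by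
    apply Real.sqrt_le_iff.2 ⟨by positivity, ?_⟩
    have h1 := Real.add_one_le_exp (-(d / δ) ^ 2)
    have h2 : Real.exp (-(d / δ) ^ 2 / 2) ^ 2 = Real.exp (-(d / δ) ^ 2) := by
      rw [← Real.exp_nat_mul]; congr 1; push_cast; ring
    rw [mul_pow, h2]
    calc δ ^ 2 - d ^ 2 = (-(d / δ) ^ 2 + 1) * δ ^ 2 := by field_simp; ring
      _ ≤ _ := by gcongr
  calc volume (L ∩ Metric.closedBall y δ)
      ≤ volume (Metric.closedBall p (Real.exp (-(d / δ) ^ 2 / 2) * δ)) :=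
        measure_mono ((inter_closedBall_subset hL hp hyp δ).trans
          (Metric.closedBall_subset_closedBall hrad))
    _ = _ := by
      rw [Measure.addHaar_closedBall_mul _ _ (Real.exp_pos _).le hδ.le, finrank_euclideanSpace_fin,
        ← Real.exp_nat_mul]
      congr 3
      rw [mul_div_assoc, mul_pow, Real.sq_sqrt (Nat.cast_nonneg n)]
      ring

/-- The `s`-neighbourhood of a convex set containing a ball of radius `r` has volume at most
`(1 + s / r) ^ n` times that of the set. -/
lemma volume_thickening_le {L : Set (EuclideanSpace ℝ (Fin n))} (hL : Convex ℝ L)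
    {c : EuclideanSpace ℝ (Fin n)} {r s : ℝ} (hr : 0 < r) (hs : 0 < s)
    (hball : Metric.ball c r ⊆ L) :
    volume (Metric.thickening s L) ≤ ENNReal.ofReal ((1 + s / r) ^ n) * volume L := by
  have hsub : Metric.thickening s L ⊆ AffineMap.homothety c (1 + s / r) '' L := by
    intro y hy
    obtain ⟨x, hx, hxy⟩ := Metric.mem_thickening_iff.1 hy
    -- With `w = c + (r / s)(y - x)`, the dilation sends `(r x + s w) / (r + s)` to `y`.
    have hw : c + (r / s) • (y - x) ∈ L := by
      apply hball
      rw [Metric.mem_ball, dist_eq_norm, add_sub_cancel_left, norm_smul, Real.norm_eq_abs,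
        abs_of_pos (by positivity), ← dist_eq_norm]
      calc r / s * dist y x < r / s * s := by gcongr
        _ = r := by field_simp
    have hcomb := hL hx hw (a := r / (r + s)) (b := s / (r + s)) (by positivity) (by positivity)
      (by field_simp)
    refine ⟨_, hcomb, ?_⟩
    rw [AffineMap.homothety_apply, vsub_eq_sub, vadd_eq_add]
    ext i
    simp only [PiLp.add_apply, PiLp.smul_apply, PiLp.sub_apply, smul_eq_mul]
    field_simp
    ring
  refine (measure_mono hsub).trans_eq ?_
  rw [Measure.addHaar_image_homothety, finrank_euclideanSpace_fin, abs_of_nonneg (by positivity)]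

lemma volume_thickening_diff_le {L : Set (EuclideanSpace ℝ (Fin n))} (hL : Convex ℝ L)
    {c : EuclideanSpace ℝ (Fin n)} {r s : ℝ} (hr : 0 < r) (hs : 0 < s)
    (hball : Metric.ball c r ⊆ L) (hfin : volume L ≠ ∞) :
    volume (Metric.thickening s L \ L) ≤
      ENNReal.ofReal (Real.exp (n * (s / r)) - 1) * volume L := by
  rw [measure_sdiff (Metric.self_subset_thickening hs L) (hL.nullMeasurableSet _) hfin]
  calc volume (Metric.thickening s L) - volume L
      ≤ ENNReal.ofReal (Real.exp (n * (s / r))) * volume L - volume L := by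
        gcongr
        refine (volume_thickening_le hL hr hs hball).trans ?_
        gcongr
        rw [Real.exp_nat_mul]
        gcongr
        linarith [Real.add_one_le_exp (s / r)]
    _ = _ := by
      rw [ENNReal.ofReal_sub _ zero_le_one, ENNReal.ofReal_one, ENNReal.sub_mul, one_mul]
      exact fun _ _ => hfin

/-- Convexity of `exp` between `0` and `x`; it pulls the small factor `η` out of every shell
estimate. -/
lemma exp_mul_sub_one_le {η x : ℝ} (h0 : 0 ≤ η) (h1 : η ≤ 1) :
    Real.exp (η * x) - 1 ≤ η * Real.exp x := by
  have h := convexOn_exp.2 (Set.mem_univ x) (Set.mem_univ 0) h0 (sub_nonneg.2 h1) (by ring)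
  simp only [smul_eq_mul, mul_zero, add_zero, Real.exp_zero, mul_one] at h
  linarith

/-- The geometric sum is `e² / (1 - e^(-1/2)) ≈ 18.8`, the source of the constant 19. -/
lemma tsum_ofReal_exp_le :
    ∑' j : ℕ, ENNReal.ofReal (Real.exp (2 - j / 2)) ≤ ENNReal.ofReal 19 := by
  have hq : Real.exp (-(1 / 2)) ≤ 0.6066 := by
    have h := Real.exp_one_gt_d9
    have h2 : Real.exp (-(1 / 2)) ^ 2 * Real.exp 1 = 1 := by
      rw [← Real.exp_nat_mul, ← Real.exp_add]; norm_num
    by_contra! hc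
    have h3 : (0.6066 : ℝ) ^ 2 < Real.exp (-(1 / 2)) ^ 2 := by gcongr
    nlinarith
  have h2 : Real.exp 2 ≤ 7.3891 := by
    have h := Real.exp_one_lt_d9
    have : Real.exp 2 = Real.exp 1 ^ 2 := by rw [← Real.exp_nat_mul]; norm_num
    rw [this]
    nlinarith [Real.exp_pos 1]
  have hs : HasSum (fun j : ℕ => Real.exp (2 - j / 2))
      (Real.exp 2 * (1 - Real.exp (-(1 / 2)))⁻¹) := by
    have := (hasSum_geometric_of_lt_one (Real.exp_pos (-(1 / 2))).le
      (by linarith)).mul_left (Real.exp 2)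
    refine this.congr_fun ?_
    intro j
    rw [← Real.exp_nat_mul, ← Real.exp_add]
    congr 1; ring
  rw [← ENNReal.ofReal_tsum_of_nonneg (fun _ => (Real.exp_pos _).le) hs.summable, hs.tsum_eq]
  apply ENNReal.ofReal_le_ofReal
  rw [← div_eq_mul_inv, div_le_iff₀ (by linarith)]
  linarith

/-- Gaussian-weighted volume outside a convex set that contains a ball of radius `r`. -/
lemma lintegral_compl_exp_le (hn : 1 ≤ n) {L : Set (EuclideanSpace ℝ (Fin n))} (hL : Convex ℝ L)
    {c : EuclideanSpace ℝ (Fin n)} {r δ : ℝ} (hr : 0 < r) (hδ : 0 < δ)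
    (hball : Metric.ball c r ⊆ L) (hfin : volume L ≠ ∞) (hη : δ * √n / r ≤ 1) :
    ∫⁻ y in Lᶜ, ENNReal.ofReal (Real.exp (-(√n * Metric.infDist y L / δ) ^ 2 / 2)) ≤
      ENNReal.ofReal (19 * (δ * √n / r)) * volume L := by
  have hn' : 0 < √(n : ℝ) := Real.sqrt_pos.2 (by exact_mod_cast hn)
  have hne : L.Nonempty := ⟨c, hball (Metric.mem_ball_self hr)⟩
  -- The width `δ / √n` is the decay scale of the weight. The shift `j + 1` puts `y` in the
  -- neighbourhood of index `⌊q⌋`, where the weight is at most `exp (-⌊q⌋² / 2)`.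
  let s : ℕ → ℝ := fun j => δ * (j + 1) / √n
  have hs : ∀ j, 0 < s j := fun j => by positivity
  have hpt : ∀ y, ENNReal.ofReal (Real.exp (-(√n * Metric.infDist y L / δ) ^ 2 / 2)) ≤
      ∑' j : ℕ, (Metric.thickening (s j) L).indicator
        (fun _ => ENNReal.ofReal (Real.exp (-(j : ℝ) ^ 2 / 2))) y := by
    intro y
    set q := √n * Metric.infDist y L / δ with hq
    have hq0 : 0 ≤ q := by have := Metric.infDist_nonneg (x := y) (s := L); positivity
    refine le_trans ?_ (ENNReal.le_tsum ⌊q⌋₊)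
    have hlt := Nat.lt_floor_add_one q
    have hmem : y ∈ Metric.thickening (s ⌊q⌋₊) L := by
      rw [Metric.mem_thickening_iff_infDist_lt hne]
      rw [lt_div_iff₀ hn']
      rw [hq, div_lt_iff₀ hδ, ← hq] at hlt
      linarith
    rw [Set.indicator_of_mem hmem]
    gcongr
    exact Nat.floor_le hq0
  calc ∫⁻ y in Lᶜ, ENNReal.ofReal (Real.exp (-(√n * Metric.infDist y L / δ) ^ 2 / 2))
      ≤ ∫⁻ y in Lᶜ, ∑' j : ℕ, (Metric.thickening (s j) L).indicator
        (fun _ => ENNReal.ofReal (Real.exp (-(j : ℝ) ^ 2 / 2))) y := lintegral_mono hpt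
    _ = ∑' j : ℕ, ENNReal.ofReal (Real.exp (-(j : ℝ) ^ 2 / 2)) *
          volume (Metric.thickening (s j) L \ L) := by
      rw [lintegral_tsum fun j => (measurable_const.indicator
        Metric.isOpen_thickening.measurableSet).aemeasurable]
      congr 1; ext j
      rw [lintegral_indicator_const Metric.isOpen_thickening.measurableSet,
        Measure.restrict_apply Metric.isOpen_thickening.measurableSet, Set.sdiff_eq]
    _ ≤ ∑' j : ℕ, ENNReal.ofReal (Real.exp (2 - j / 2)) *
          (ENNReal.ofReal (δ * √n / r) * volume L) := by
      refine ENNReal.tsum_le_tsum fun j => ?_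
      calc _ ≤ ENNReal.ofReal (Real.exp (-(j : ℝ) ^ 2 / 2)) *
            (ENNReal.ofReal (δ * √n / r * Real.exp (j + 1)) * volume L) := by
            gcongr
            refine (volume_thickening_diff_le hL hr (hs j) hball hfin).trans ?_
            gcongr
            have : (n : ℝ) * (s j / r) = δ * √n / r * (j + 1) := by
              simp only [s]
              field_simp
              rw [Real.sq_sqrt (Nat.cast_nonneg n)]
            rw [this]
            exact exp_mul_sub_one_le (by positivity) hη
        _ = ENNReal.ofReal (Real.exp (-(j : ℝ) ^ 2 / 2 + (j + 1))) *
            (ENNReal.ofReal (δ * √n / r) * volume L) := by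
            rw [Real.exp_add (-(j : ℝ) ^ 2 / 2), ENNReal.ofReal_mul (Real.exp_pos _).le,
              ENNReal.ofReal_mul (by positivity)]
            ring
        _ ≤ _ := by
            gcongr
            -- Equivalent to `-j²/2 + j + 1 ≤ 2 - j/2`; no integer lies strictly between 1 and 2.
            have : 0 ≤ ((j : ℝ) - 1) * (j - 2) := by
              rcases j with _ | _ | j
              · norm_num
              · norm_num
              · push_cast
                have : (0 : ℝ) ≤ j := Nat.cast_nonneg j
                nlinarith
            nlinarith
    _ ≤ ENNReal.ofReal 19 * (ENNReal.ofReal (δ * √n / r) * volume L) := by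
      rw [ENNReal.tsum_mul_right]
      gcongr
      exact tsum_ofReal_exp_le
    _ = _ := by rw [ENNReal.ofReal_mul (by norm_num), mul_assoc]

/-- Swapping the roles of the two ends of a short step. -/
lemma lintegral_volume_closedBall_diff {L : Set (EuclideanSpace ℝ (Fin n))}
    (hLm : MeasurableSet L) (δ : ℝ) :
    ∫⁻ x in L, volume (Metric.closedBall x δ \ L) =
      ∫⁻ y in Lᶜ, volume (L ∩ Metric.closedBall y δ) := by
  let T : Set (EuclideanSpace ℝ (Fin n) × EuclideanSpace ℝ (Fin n)) :=
    {z | z.1 ∈ L ∧ z.2 ∈ Lᶜ ∧ dist z.1 z.2 ≤ δ}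
  have hT : MeasurableSet T :=
    (measurable_fst hLm).inter ((measurable_snd hLm.compl).inter
      (measurableSet_le measurable_dist measurable_const))
  have h1 := Measure.prod_apply (μ := volume) (ν := volume) hT
  have h2 := Measure.prod_apply_symm (μ := volume) (ν := volume) hT
  rw [h1] at h2
  rw [← lintegral_indicator hLm, ← lintegral_indicator hLm.compl]
  refine Eq.trans (lintegral_congr fun x => ?_) (h2.trans (lintegral_congr fun y => ?_))
  · by_cases hx : x ∈ L
    · rw [Set.indicator_of_mem hx]
      congr 1; ext y
      simp [T, hx, dist_comm, and_comm]
    · have hempty : Prod.mk x ⁻¹' T = ∅ := by ext y; simp [T, hx]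
      rw [Set.indicator_of_notMem hx, hempty, measure_empty]
  · by_cases hy : y ∈ L
    · have hempty : (fun x => (x, y)) ⁻¹' T = ∅ := by ext x; simp [T, hy]
      rw [Set.indicator_of_notMem (by simpa using hy), hempty, measure_empty]
    · rw [Set.indicator_of_mem (by simpa using hy)]
      congr 1; ext x
      simp [T, hy]

/-- Average escape probability from a closed convex set containing a ball of radius `r`. -/
lemma lintegral_volume_closedBall_diff_le_of_isClosed (hn : 1 ≤ n)
    {L : Set (EuclideanSpace ℝ (Fin n))} (hL : Convex ℝ L) (hLc : IsClosed L)
    {c : EuclideanSpace ℝ (Fin n)} {r δ : ℝ} (hr : 0 < r) (hδ : 0 < δ)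
    (hball : Metric.ball c r ⊆ L) (hfin : volume L ≠ ∞) :
    ∫⁻ x in L, volume (Metric.closedBall x δ \ L) ≤
      ENNReal.ofReal (19 * (δ * √n / r)) * volume L *
        volume (Metric.closedBall (0 : EuclideanSpace ℝ (Fin n)) δ) := by
  rcases le_or_gt (δ * √n / r) 1 with hη | hη
  · rw [lintegral_volume_closedBall_diff hLc.measurableSet]
    refine (lintegral_mono fun y => volume_inter_closedBall_le hL hLc
      ⟨c, hball (Metric.mem_ball_self hr)⟩ hδ y).trans ?_
    rw [lintegral_mul_const' _ _ measure_closedBall_lt_top.ne]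
    gcongr
    exact lintegral_compl_exp_le hn hL hr hδ hball hfin hη
  · calc ∫⁻ x in L, volume (Metric.closedBall x δ \ L)
        ≤ ∫⁻ x in L, volume (Metric.closedBall (0 : EuclideanSpace ℝ (Fin n)) δ) := by
          refine lintegral_mono fun x => (measure_mono Set.sdiff_subset).trans_eq ?_
          exact Measure.addHaar_closedBall_center _ _ _
      _ = 1 * volume L * volume (Metric.closedBall (0 : EuclideanSpace ℝ (Fin n)) δ) := by
          rw [setLIntegral_const]; ring
      _ ≤ _ := by
          gcongr
          rw [← ENNReal.ofReal_one]
          exact ENNReal.ofReal_le_ofReal (by linarith)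

/-- Average escape probability from a convex set containing a ball of radius `r`. -/
lemma lintegral_volume_closedBall_diff_le (hn : 1 ≤ n)
    {L : Set (EuclideanSpace ℝ (Fin n))} (hL : Convex ℝ L)
    {c : EuclideanSpace ℝ (Fin n)} {r δ : ℝ} (hr : 0 < r) (hδ : 0 < δ)
    (hball : Metric.ball c r ⊆ L) (hfin : volume L ≠ ∞) :
    ∫⁻ x in L, volume (Metric.closedBall x δ \ L) ≤
      ENNReal.ofReal (19 * (δ * √n / r)) * volume L *
        volume (Metric.closedBall (0 : EuclideanSpace ℝ (Fin n)) δ) := by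
  -- The frontier of a convex set is null, so passing to the closure changes no volume.
  have hnull : volume (closure L \ L) = 0 := by
    refine measure_mono_null ?_ (hL.addHaar_frontier volume)
    exact Set.sdiff_subset_sdiff_right interior_subset
  have hvol : volume (closure L) = volume L :=
    le_antisymm (by
      calc volume (closure L) ≤ volume (L ∪ (closure L \ L)) := by
            apply measure_mono; intro x hx; by_cases h : x ∈ L <;> simp [h, hx]
        _ ≤ volume L + volume (closure L \ L) := measure_union_le _ _
        _ = volume L := by rw [hnull, add_zero]) (measure_mono subset_closure)
  rw [← hvol] at hfin ⊢
  refine le_trans ?_ (lintegral_volume_closedBall_diff_le_of_isClosed hn hL.closure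
    isClosed_closure hr hδ (hball.trans subset_closure) hfin)
  refine (lintegral_mono' (Measure.restrict_mono subset_closure le_rfl) fun x => ?_)
  calc volume (Metric.closedBall x δ \ L)
      ≤ volume ((Metric.closedBall x δ \ closure L) ∪ (closure L \ L)) := by
        apply measure_mono; intro y hy; by_cases h : y ∈ closure L <;> simp_all
    _ ≤ volume (Metric.closedBall x δ \ closure L) + volume (closure L \ L) := measure_union_le _ _
    _ = _ := by rw [hnull, add_zero]

end Geometry

/-! ### From level sets to rounded logconcave densities. -/

section Density

variable {n : ℕ}

lemma measurable_volume_inter_closedBall {K : Set (EuclideanSpace ℝ (Fin n))}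
    (hK : NullMeasurableSet K) (δ : ℝ) :
    Measurable fun x => volume (K ∩ Metric.closedBall x δ) := by
  obtain ⟨K', hK', hae⟩ := hK
  have heq : (fun x => volume (K ∩ Metric.closedBall x δ)) =
      fun x => volume (Prod.mk x ⁻¹' {z : EuclideanSpace ℝ (Fin n) × EuclideanSpace ℝ (Fin n) |
        z.2 ∈ K' ∧ dist z.2 z.1 ≤ δ}) := by
    ext x
    exact measure_congr (hae.inter (ae_eq_refl _))
  rw [heq]
  exact measurable_measure_prodMk_left ((measurable_snd hK').inter
    (measurableSet_le (measurable_snd.dist measurable_fst) measurable_const))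

lemma measurable_volume_closedBall_diff {K : Set (EuclideanSpace ℝ (Fin n))}
    (hK : NullMeasurableSet K) (δ : ℝ) :
    Measurable fun x => volume (Metric.closedBall x δ \ K) := by
  simp_rw [Set.sdiff_eq, Set.inter_comm _ Kᶜ]
  exact measurable_volume_inter_closedBall hK.compl δ

variable {f : EuclideanSpace ℝ (Fin n) → ℝ}

lemma IsLogConcave.convex_levelSet (hf : IsLogConcave f) {t : ℝ} (ht : 0 < t) :
    Convex ℝ (levelSet f t) := by
  intro x hx y hy s s' hs hs' hss
  obtain rfl : s' = 1 - s := by linarith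
  have hx' : t ≤ f x := hx
  have hy' : t ≤ f y := hy
  calc t = t ^ s * t ^ (1 - s) := by rw [← Real.rpow_add ht, add_sub_cancel, Real.rpow_one]
    _ ≤ f x ^ s * f y ^ (1 - s) := by
      have := Real.rpow_nonneg (hf.1 x) s
      gcongr
    _ ≤ _ := hf.2 x y s hs (by linarith)

lemma IsLogConcave.convex_support (hf : IsLogConcave f) : Convex ℝ (Function.support f) := by
  intro x hx y hy s s' hs hs' hss
  obtain rfl : s' = 1 - s := by linarith
  have hx' : 0 < f x := (hf.1 x).lt_of_ne' hx
  have hy' : 0 < f y := (hf.1 y).lt_of_ne' hy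
  exact (lt_of_lt_of_le (by positivity) (hf.2 x y s hs (by linarith))).ne'

lemma levelSet_anti (f : EuclideanSpace ℝ (Fin n) → ℝ) {s t : ℝ} (h : s ≤ t) :
    levelSet f t ⊆ levelSet f s := fun _ hx => h.trans hx

lemma IsProbDensity.lintegral_eq_one (hf : IsProbDensity f) :
    ∫⁻ x, ENNReal.ofReal (f x) = 1 := by
  rw [← ofReal_integral_eq_lintegral_ofReal hf.integrable (ae_of_all _ hf.nonneg),
    hf.integral_eq_one, ENNReal.ofReal_one]

lemma IsProbDensity.setLIntegral (hf : IsProbDensity f) (L : Set (EuclideanSpace ℝ (Fin n))) :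
    ∫⁻ x in L, ENNReal.ofReal (f x) = ENNReal.ofReal (∫ x in L, f x) :=
  (ofReal_integral_eq_lintegral_ofReal hf.integrable.integrableOn
    (ae_of_all _ hf.nonneg)).symm

lemma IsProbDensity.volume_levelSet_ne_top (hf : IsProbDensity f) {t : ℝ} (ht : 0 < t) :
    volume (levelSet f t) ≠ ∞ := by
  refine ne_top_of_le_ne_top (hf.integrable.measure_norm_ge_lt_top ht).ne (measure_mono ?_)
  exact fun x (hx : t ≤ f x) => hx.trans (le_abs_self (f x))

/-- The union of the level sets of measure less than `b` has measure at most `b`. -/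
lemma IsProbDensity.setLIntegral_small_levelSets_le (hf : IsProbDensity f) (b : ℝ) :
    ∫⁻ x in {x | 0 < f x ∧ ∫ y in levelSet f (f x), f y < b}, ENNReal.ofReal (f x) ≤
      ENNReal.ofReal b := by
  set T : Set ℝ := {t | 0 < t ∧ ∫ y in levelSet f t, f y < b} with hT
  have hlevel : ∀ t ∈ T, ∫⁻ x in levelSet f t, ENNReal.ofReal (f x) ≤ ENNReal.ofReal b := by
    intro t ht
    rw [hf.setLIntegral]
    exact ENNReal.ofReal_le_ofReal ht.2.le
  rcases T.eq_empty_or_nonempty with h0 | hne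
  · have : {x | 0 < f x ∧ ∫ y in levelSet f (f x), f y < b} = ∅ :=
      Set.eq_empty_of_forall_notMem fun x (hx : f x ∈ T) => by rw [h0] at hx; exact hx
    rw [this]
    simp
  have hbdd : BddBelow T := ⟨0, fun t ht => ht.1.le⟩
  -- If the infimum is attained, one level set contains the whole union; otherwise levels decreasing
  -- to it exhaust the union, and continuity from below applies.
  by_cases hmem : sInf T ∈ T
  · refine le_trans (lintegral_mono_set ?_) (hlevel _ hmem)
    exact fun x (hx : f x ∈ T) => csInf_le hbdd hx
  · obtain ⟨u, hu, hlim, huT⟩ := exists_seq_tendsto_sInf hne hbdd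
    have hsub : {x | 0 < f x ∧ ∫ y in levelSet f (f x), f y < b} ⊆ ⋃ k, levelSet f (u k) := by
      intro x (hx : f x ∈ T)
      have hlt : sInf T < f x :=
        (csInf_le hbdd hx).lt_of_ne fun h => hmem (h ▸ hx)
      obtain ⟨k, hk⟩ := (hlim.eventually (gt_mem_nhds hlt)).exists
      exact Set.mem_iUnion.2 ⟨k, le_of_lt hk⟩
    have hmono : Monotone fun k => levelSet f (u k) := fun i j hij => levelSet_anti f (hu hij)
    calc _ ≤ ∫⁻ x in ⋃ k, levelSet f (u k), ENNReal.ofReal (f x) := lintegral_mono_set hsub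
      _ = volume.withDensity (fun x => ENNReal.ofReal (f x)) (⋃ k, levelSet f (u k)) :=
        (withDensity_apply' _ _).symm
      _ = ⨆ k, volume.withDensity (fun x => ENNReal.ofReal (f x)) (levelSet f (u k)) :=
        hmono.measure_iUnion
      _ ≤ _ := iSup_le fun k => by
        rw [withDensity_apply']
        exact hlevel _ (huT k)

/-- Average escape volume for a rounded logconcave density. -/
lemma lintegral_mul_volume_closedBall_diff_le (hn : 1 ≤ n) {a δ : ℝ} (ha : 0 < a) (hδ : 0 < δ)
    (hf : IsProbDensity f) (hlc : IsLogConcave f) (hr : IsRounded a f) :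
    ∫⁻ x, ENNReal.ofReal (f x) * volume (Metric.closedBall x δ \ Function.support f) ≤
      ENNReal.ofReal (20 * √(δ * √n / a)) *
        volume (Metric.closedBall (0 : EuclideanSpace ℝ (Fin n)) δ) := by
  have hn' : 0 < √(n : ℝ) := Real.sqrt_pos.2 (by exact_mod_cast hn)
  set V := volume (Metric.closedBall (0 : EuclideanSpace ℝ (Fin n)) δ) with hV
  set ε := δ * √n / a with hε
  have hε0 : 0 < ε := by positivity
  have hb : 0 < √ε := Real.sqrt_pos.2 hε0
  set g : EuclideanSpace ℝ (Fin n) → ℝ≥0∞ :=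
    fun x => volume (Metric.closedBall x δ \ Function.support f) with hg
  have hgm : Measurable g :=
    measurable_volume_closedBall_diff (hlc.convex_support.nullMeasurableSet _) δ
  have hfm : AEMeasurable f volume := hf.integrable.aestronglyMeasurable.aemeasurable
  set S : Set (EuclideanSpace ℝ (Fin n)) :=
    {x | 0 < f x ∧ ∫ y in levelSet f (f x), f y < √ε} with hS
  have hlevel : ∀ t : ℝ, 0 < t → ∫⁻ x in levelSet f t, g x ≤
      ENNReal.ofReal (19 * √ε) * V * volume (levelSet f t) +
        V * volume.restrict S (levelSet f t) := by
    intro t ht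
    -- The threshold `√ε` balances the escape bound `19 ε / m` of heavy level sets against the total
    -- mass of light ones.
    rcases le_or_gt (√ε) (∫ y in levelSet f t, f y) with hm | hm
    · refine le_trans ?_ le_self_add
      obtain ⟨c, hc⟩ := hr t ht
      set m := ∫ y in levelSet f t, f y with hmdef
      have hm0 : 0 < m := hb.trans_le hm
      calc ∫⁻ x in levelSet f t, g x
          ≤ ∫⁻ x in levelSet f t, volume (Metric.closedBall x δ \ levelSet f t) :=
            lintegral_mono fun x => measure_mono (Set.sdiff_subset_sdiff_right
              fun y (hy : t ≤ f y) => (ht.trans_le hy).ne')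
        _ ≤ ENNReal.ofReal (19 * (δ * √n / (a * m))) * volume (levelSet f t) * V :=
            lintegral_volume_closedBall_diff_le hn (hlc.convex_levelSet ht) (by positivity) hδ hc
              (hf.volume_levelSet_ne_top ht)
        _ ≤ ENNReal.ofReal (19 * √ε) * volume (levelSet f t) * V := by
            gcongr
            rw [← div_div, ← hε, div_le_iff₀ hm0]
            calc ε = √ε * √ε := (Real.mul_self_sqrt hε0.le).symm
              _ ≤ _ := by gcongr
        _ = _ := by ring
    · refine le_trans ?_ le_add_self
      have hsub : levelSet f t ⊆ S := by
        intro x hx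
        refine ⟨ht.trans_le hx, lt_of_le_of_lt ?_ hm⟩
        exact setIntegral_mono_set hf.integrable.integrableOn (ae_of_all _ hf.nonneg)
          (levelSet_anti f hx).eventuallyLE
      rw [Measure.restrict_eq_self _ hsub]
      calc ∫⁻ x in levelSet f t, g x ≤ ∫⁻ x in levelSet f t, V :=
            lintegral_mono fun x => (measure_mono Set.sdiff_subset).trans_eq
              (Measure.addHaar_closedBall_center _ _ _)
        _ = _ := setLIntegral_const _ _
  calc ∫⁻ x, ENNReal.ofReal (f x) * g x
      -- Absorbing `g` into the measure lets the layer-cake formula act on `f` alone.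
      = ∫⁻ x, ENNReal.ofReal (f x) ∂(volume.withDensity g) := by
        rw [lintegral_withDensity_eq_lintegral_mul₀ hgm.aemeasurable hfm.ennreal_ofReal]
        simp [mul_comm]
    _ = ∫⁻ t in Set.Ioi 0, volume.withDensity g (levelSet f t) :=
        lintegral_eq_lintegral_meas_le _ (ae_of_all _ hf.nonneg)
          (hfm.mono_ac (withDensity_absolutelyContinuous _ _))
    _ ≤ ∫⁻ t in Set.Ioi 0, (ENNReal.ofReal (19 * √ε) * V * volume (levelSet f t) +
        V * volume.restrict S (levelSet f t)) := by
        refine setLIntegral_mono' measurableSet_Ioi fun t ht => ?_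
        rw [withDensity_apply']
        exact hlevel t ht
    _ = ENNReal.ofReal (19 * √ε) * V * (∫⁻ t in Set.Ioi 0, volume (levelSet f t)) +
        V * ∫⁻ t in Set.Ioi 0, volume.restrict S (levelSet f t) := by
        have h1 : Measurable fun t => volume (levelSet f t) :=
          Antitone.measurable fun s t hst => measure_mono (levelSet_anti f hst)
        have h2 : Measurable fun t => volume.restrict S (levelSet f t) :=
          Antitone.measurable fun s t hst => measure_mono (levelSet_anti f hst)
        rw [lintegral_add_left (h1.const_mul _), lintegral_const_mul _ h1,
          lintegral_const_mul _ h2]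
    _ = ENNReal.ofReal (19 * √ε) * V * (∫⁻ x, ENNReal.ofReal (f x)) +
        V * ∫⁻ x in S, ENNReal.ofReal (f x) := by
        rw [lintegral_eq_lintegral_meas_le _ (ae_of_all _ hf.nonneg) hfm,
          lintegral_eq_lintegral_meas_le _ (ae_of_all _ hf.nonneg) hfm.restrict]
        rfl
    _ ≤ ENNReal.ofReal (19 * √ε) * V * 1 + V * ENNReal.ofReal (√ε) := by
        rw [hf.lintegral_eq_one]
        gcongr
        exact hf.setLIntegral_small_levelSets_le _
    _ = ENNReal.ofReal (19 * √ε + √ε) * V := by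
        rw [ENNReal.ofReal_add (by positivity) hb.le]; ring
    _ = _ := by ring_nf

/-- The average local conductance of a rounded logconcave density. -/
theorem one_sub_le_avgLocalConductance (hn : 1 ≤ n) {a δ : ℝ} (ha : 0 < a) (hδ : 0 < δ)
    (hf : IsProbDensity f) (hlc : IsLogConcave f) (hr : IsRounded a f) :
    1 - 20 * √(δ * √n / a) ≤ avgLocalConductance δ f := by
  set K := Function.support f with hK
  have hKm : NullMeasurableSet K := hlc.convex_support.nullMeasurableSet _
  have hV0 : 0 < volume.real (Metric.closedBall (0 : EuclideanSpace ℝ (Fin n)) δ) :=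
    ENNReal.toReal_pos (Metric.measure_closedBall_pos _ _ hδ).ne' measure_closedBall_lt_top.ne
  set V := volume.real (Metric.closedBall (0 : EuclideanSpace ℝ (Fin n)) δ) with hV
  set h : EuclideanSpace ℝ (Fin n) → ℝ :=
    fun x => volume.real (Metric.closedBall x δ \ K) with hh
  have hhm : Measurable h := (measurable_volume_closedBall_diff hKm δ).ennreal_toReal
  have hhV : ∀ x, h x ≤ V := fun x => by
    rw [hV, ← Measure.addHaar_real_closedBall_center volume x]
    exact measureReal_mono Set.sdiff_subset measure_closedBall_lt_top.ne
  have hloc : ∀ x, localConductance K δ x = 1 - h x / V := by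
    intro x
    have hadd := measureReal_inter_add_sdiff₀ (μ := volume) (s := Metric.closedBall x δ) hKm
      measure_closedBall_lt_top.ne
    rw [Measure.addHaar_real_closedBall_center, Set.inter_comm] at hadd
    rw [localConductance, ← hV, eq_sub_iff_add_eq, ← add_div, div_eq_one_iff_eq hV0.ne']
    exact hadd
  have hint : Integrable fun x => h x / V * f x := by
    refine hf.integrable.bdd_mul (c := 1) (hhm.div_const V).aestronglyMeasurable
      (ae_of_all _ fun x => ?_)
    rw [Real.norm_eq_abs, abs_of_nonneg (div_nonneg measureReal_nonneg hV0.le)]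
    exact div_le_one_of_le₀ (hhV x) hV0.le
  have hzero : ∀ x, x ∉ K → f x = 0 := fun x hx => by simpa [hK] using hx
  have hden : ∫ x in K, f x = 1 := by
    rw [setIntegral_eq_integral_of_forall_compl_eq_zero hzero, hf.integral_eq_one]
  have hnum : ∫ x in K, localConductance K δ x * f x = 1 - ∫ x, h x / V * f x := by
    rw [setIntegral_eq_integral_of_forall_compl_eq_zero fun x hx => by rw [hzero x hx, mul_zero],
      ← hf.integral_eq_one, ← integral_sub hf.integrable hint]
    congr 1; ext x
    rw [hloc x]; ring
  rw [avgLocalConductance, ← hK, hden, hnum, div_one]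
  apply sub_le_sub_left
  have hnn : ∀ x, 0 ≤ h x / V * f x := fun x =>
    mul_nonneg (div_nonneg measureReal_nonneg hV0.le) (hf.nonneg x)
  rw [← ENNReal.ofReal_le_ofReal_iff (by positivity),
    ofReal_integral_eq_lintegral_ofReal hint (ae_of_all _ hnn)]
  have hVe : volume (Metric.closedBall (0 : EuclideanSpace ℝ (Fin n)) δ) = ENNReal.ofReal V :=
    (ENNReal.ofReal_toReal measure_closedBall_lt_top.ne).symm
  have hkey := lintegral_mul_volume_closedBall_diff_le hn ha hδ hf hlc hr
  rw [hVe] at hkey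
  have hpt : ∀ x, ENNReal.ofReal (h x / V * f x) =
      ENNReal.ofReal (f x) * volume (Metric.closedBall x δ \ K) * (ENNReal.ofReal V)⁻¹ := by
    intro x
    have hx : volume (Metric.closedBall x δ \ K) = ENNReal.ofReal (h x) :=
      (ENNReal.ofReal_toReal (measure_ne_top_of_subset Set.sdiff_subset
        measure_closedBall_lt_top.ne)).symm
    rw [hx, ENNReal.ofReal_mul (div_nonneg measureReal_nonneg hV0.le),
      ENNReal.ofReal_div_of_pos hV0, div_eq_mul_inv]
    ring
  simp_rw [hpt]
  rw [lintegral_mul_const' _ _ (ENNReal.inv_ne_top.2 (ENNReal.ofReal_pos.2 hV0).ne'),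
    ← div_eq_mul_inv]
  exact ENNReal.div_le_of_le_mul hkey

end Density

/-! ### Gaussians restricted to convex sets. -/

section Gaussian

variable {n : ℕ} {σ : ℝ} {K : Set (EuclideanSpace ℝ (Fin n))}

lemma integrable_exp_neg_sq_norm_div (n : ℕ) (hσ : 0 < σ) :
    Integrable fun x : EuclideanSpace ℝ (Fin n) => Real.exp (-‖x‖ ^ 2 / (2 * σ ^ 2)) := by
  have h := GaussianFourier.integral_rexp_neg_mul_sq_norm (V := EuclideanSpace ℝ (Fin n))
    (b := (2 * σ ^ 2)⁻¹) (by positivity)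
  have h2 : Integrable fun x : EuclideanSpace ℝ (Fin n) =>
      Real.exp (-(2 * σ ^ 2)⁻¹ * ‖x‖ ^ 2) := by
    refine Integrable.of_integral_ne_zero ?_
    rw [h]
    positivity
  refine h2.congr (ae_of_all _ fun x => ?_)
  simp only
  congr 1
  field_simp

/-- The integrand is at least `e^(-1/2)` on the ball of radius `σ`, which lies in `K` because `σ ≤
1`. -/
lemma le_setIntegral_exp (hσ : 0 < σ) (hσ1 : σ ≤ 1) (hball : Metric.closedBall 0 1 ⊆ K) :
    Real.exp (-(1 / 2)) * volume.real (Metric.closedBall (0 : EuclideanSpace ℝ (Fin n)) σ) ≤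
      ∫ y in K, Real.exp (-‖y‖ ^ 2 / (2 * σ ^ 2)) := by
  have hint := integrable_exp_neg_sq_norm_div n hσ
  refine (setIntegral_ge_of_const_le_real (f := fun y : EuclideanSpace ℝ (Fin n) =>
      Real.exp (-‖y‖ ^ 2 / (2 * σ ^ 2))) measurableSet_closedBall
    measure_closedBall_lt_top.ne ?_ hint.integrableOn).trans
    (setIntegral_mono_set hint.integrableOn (ae_of_all _ fun _ => (Real.exp_pos _).le)
      ((Metric.closedBall_subset_closedBall hσ1).trans hball).eventuallyLE)
  intro x hx
  rw [mem_closedBall_zero_iff] at hx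
  rw [Real.exp_le_exp, le_div_iff₀ (by positivity)]
  have : ‖x‖ ^ 2 ≤ σ ^ 2 := by gcongr
  linarith

lemma setIntegral_exp_pos (hσ : 0 < σ) (hσ1 : σ ≤ 1) (hball : Metric.closedBall 0 1 ⊆ K) :
    0 < ∫ y in K, Real.exp (-‖y‖ ^ 2 / (2 * σ ^ 2)) :=
  lt_of_lt_of_le (mul_pos (Real.exp_pos _) (ENNReal.toReal_pos
    (Metric.measure_closedBall_pos _ _ hσ).ne' measure_closedBall_lt_top.ne))
    (le_setIntegral_exp hσ hσ1 hball)

lemma restrictedGaussian_nonneg (x : EuclideanSpace ℝ (Fin n)) :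
    0 ≤ restrictedGaussian K σ x :=
  Set.indicator_nonneg (fun _ _ => div_nonneg (Real.exp_pos _).le
    (integral_nonneg fun _ => (Real.exp_pos _).le)) x

lemma isProbDensity_restrictedGaussian (hσ : 0 < σ) (hσ1 : σ ≤ 1) (hK : Convex ℝ K)
    (hball : Metric.closedBall 0 1 ⊆ K) : IsProbDensity (restrictedGaussian K σ) where
  nonneg := restrictedGaussian_nonneg
  integrable := ((integrable_exp_neg_sq_norm_div n hσ).div_const _).indicator₀
    (hK.nullMeasurableSet _)
  integral_eq_one := by
    rw [restrictedGaussian, integral_indicator₀ (hK.nullMeasurableSet _), integral_div,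
      div_self (setIntegral_exp_pos hσ hσ1 hball).ne']

lemma isLogConcave_restrictedGaussian (hσ : 0 < σ) (hσ1 : σ ≤ 1) (hK : Convex ℝ K)
    (hball : Metric.closedBall 0 1 ⊆ K) : IsLogConcave (restrictedGaussian K σ) := by
  refine ⟨restrictedGaussian_nonneg, fun x y s hs0 hs1 => ?_⟩
  -- The endpoints are separate because `0 ^ 0 = 1`; for `0 < s < 1` a point outside `K` makes the
  -- left side vanish.
  rcases hs0.eq_or_lt with rfl | hs0'
  · simp
  rcases hs1.eq_or_lt with rfl | hs1'
  · simp
  have hs' : 0 < 1 - s := by linarith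
  by_cases hx : x ∈ K
  · by_cases hy : y ∈ K
    · have hxy : s • x + (1 - s) • y ∈ K := hK hx hy hs0 hs'.le (by ring)
      have hZ := setIntegral_exp_pos hσ hσ1 hball
      rw [restrictedGaussian, Set.indicator_of_mem hx, Set.indicator_of_mem hy,
        Set.indicator_of_mem hxy]
      set Z := ∫ y in K, Real.exp (-‖y‖ ^ 2 / (2 * σ ^ 2))
      rw [Real.div_rpow (Real.exp_pos _).le hZ.le, Real.div_rpow (Real.exp_pos _).le hZ.le,
        div_mul_div_comm, ← Real.rpow_add hZ, add_sub_cancel, Real.rpow_one, ← Real.exp_mul,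
        ← Real.exp_mul, ← Real.exp_add]
      gcongr
      have hnorm : ‖s • x + (1 - s) • y‖ ≤ s * ‖x‖ + (1 - s) * ‖y‖ := by
        refine (norm_add_le _ _).trans_eq ?_
        rw [norm_smul_of_nonneg hs0, norm_smul_of_nonneg hs'.le]
      have hsq : ‖s • x + (1 - s) • y‖ ^ 2 ≤ s * ‖x‖ ^ 2 + (1 - s) * ‖y‖ ^ 2 := by
        calc _ ≤ (s * ‖x‖ + (1 - s) * ‖y‖) ^ 2 := by gcongr
          _ ≤ _ := by nlinarith [mul_nonneg (mul_nonneg hs0 hs'.le) (sq_nonneg (‖x‖ - ‖y‖))]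
      calc _ = -(s * ‖x‖ ^ 2 + (1 - s) * ‖y‖ ^ 2) / (2 * σ ^ 2) := by ring
        _ ≤ _ := by gcongr
    · rw [restrictedGaussian, Set.indicator_of_notMem hy, Real.zero_rpow hs'.ne', mul_zero]
      exact restrictedGaussian_nonneg _
  · rw [restrictedGaussian, Set.indicator_of_notMem hx, Real.zero_rpow hs0'.ne', zero_mul]
    exact restrictedGaussian_nonneg _

/-- The level sets of a Gaussian restricted to a convex set contain centred balls. -/
lemma isRounded_restrictedGaussian (hn : 1 ≤ n) (hσ : 0 < σ) (hσ1 : σ ≤ 1) (hK : Convex ℝ K)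
    (hball : Metric.closedBall 0 1 ⊆ K) : IsRounded (σ / 2) (restrictedGaussian K σ) := by
  intro t ht
  refine ⟨0, fun x hx => ?_⟩
  have hprob := isProbDensity_restrictedGaussian hσ hσ1 hK hball
  set f := restrictedGaussian K σ with hf
  set m := ∫ x in levelSet f t, f x with hm
  rw [mem_ball_zero_iff] at hx
  have hm1 : m ≤ 1 := by
    rw [← hprob.integral_eq_one]
    exact setIntegral_le_integral hprob.integrable (ae_of_all _ hprob.nonneg)
  -- If `x` is missed, the level set lies in the centred ball of radius `‖x‖ < σ m / 2`, so `m ≤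
  -- e^(1/2) (‖x‖ / σ) ^ n ≤ e^(1/2) m / 2 < m`.
  by_contra hxL
  have hxL' : f x < t := not_le.1 hxL
  have hxK : x ∈ K := hball (mem_closedBall_zero_iff.2 (by nlinarith))
  have hZ := setIntegral_exp_pos hσ hσ1 hball
  have hZv := le_setIntegral_exp hσ hσ1 hball
  set Z := ∫ y in K, Real.exp (-‖y‖ ^ 2 / (2 * σ ^ 2)) with hZdef
  have hfK : ∀ y ∈ K, f y = Real.exp (-‖y‖ ^ 2 / (2 * σ ^ 2)) / Z := fun y hy =>
    Set.indicator_of_mem hy _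
  have hbound : ∀ y ∈ levelSet f t, ‖y‖ ≤ ‖x‖ ∧ f y ≤ 1 / Z := by
    intro y (hy : t ≤ f y)
    have hyK : y ∈ K := by
      by_contra h
      have : f y = 0 := Set.indicator_of_notMem h _
      linarith
    constructor
    · by_contra! h
      have : f y ≤ f x := by
        rw [hfK y hyK, hfK x hxK]
        gcongr
      linarith
    · rw [hfK y hyK]
      gcongr
      rw [Real.exp_le_one_iff]
      exact div_nonpos_of_nonpos_of_nonneg (by simp) (by positivity)
  have hv : 0 < volume.real (Metric.closedBall (0 : EuclideanSpace ℝ (Fin n)) 1) :=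
    ENNReal.toReal_pos (Metric.measure_closedBall_pos _ _ one_pos).ne'
      measure_closedBall_lt_top.ne
  set v := volume.real (Metric.closedBall (0 : EuclideanSpace ℝ (Fin n)) 1) with hvdef
  rw [Measure.addHaar_real_closedBall' _ _ hσ.le, finrank_euclideanSpace_fin, ← hvdef] at hZv
  have hsub : levelSet f t ⊆ Metric.closedBall 0 ‖x‖ := fun y hy =>
    mem_closedBall_zero_iff.2 (hbound y hy).1
  have hmle : m ≤ 1 / Z * (‖x‖ ^ n * v) := by
    calc m ≤ ‖m‖ := le_abs_self m
      _ ≤ 1 / Z * volume.real (levelSet f t) :=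
        norm_setIntegral_le_of_norm_le_const
          ((measure_mono hsub).trans_lt (measure_closedBall_lt_top (μ := volume))) fun y hy => by
            rw [Real.norm_of_nonneg (hprob.nonneg y)]; exact (hbound y hy).2
      _ ≤ 1 / Z * volume.real (Metric.closedBall (0 : EuclideanSpace ℝ (Fin n)) ‖x‖) := by
        gcongr
        exact measure_closedBall_lt_top.ne
      _ = _ := by
        rw [Measure.addHaar_real_closedBall' _ _ (norm_nonneg x), finrank_euclideanSpace_fin]
  have hexp : 1 / 2 < Real.exp (-(1 / 2)) := by
    have := Real.add_one_lt_exp (x := -(1 / 2)) (by norm_num)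
    linarith
  have hm0 : 0 < m := by
    by_contra! h
    nlinarith [norm_nonneg x]
  have hu : ‖x‖ / σ < m / 2 := by rw [div_lt_iff₀ hσ]; linarith
  have hun : (‖x‖ / σ) ^ n ≤ ‖x‖ / σ :=
    pow_le_of_le_one (by positivity) (by linarith) (by omega)
  have h1 : m * Z ≤ ‖x‖ ^ n * v := by
    rw [one_div_mul_eq_div, le_div_iff₀ hZ] at hmle
    exact hmle
  have h2 : ‖x‖ ^ n * v ≤ m / 2 * (σ ^ n * v) := by
    calc ‖x‖ ^ n * v = (‖x‖ / σ) ^ n * (σ ^ n * v) := by rw [div_pow]; field_simp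
      _ ≤ m / 2 * (σ ^ n * v) := by gcongr; linarith
  have h3 : m / 2 * (σ ^ n * v) < m * (Real.exp (-(1 / 2)) * (σ ^ n * v)) := by
    have : 0 < m * (σ ^ n * v) := by positivity
    nlinarith
  have h4 : m * (Real.exp (-(1 / 2)) * (σ ^ n * v)) ≤ m * Z := by gcongr
  linarith

end Gaussian

theorem mainTheorem8 (n : ℕ) (hn : 1 ≤ n) (δ : ℝ) (hδ : 0 < δ) :
    (∀ (a : ℝ) (f : EuclideanSpace ℝ (Fin n) → ℝ), 0 < a →
      IsProbDensity f → IsLogConcave f → IsRounded a f →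
        1 - 32 * (δ ^ (1 / 2 : ℝ) * (n : ℝ) ^ (1 / 4 : ℝ) / a ^ (1 / 2 : ℝ))
          ≤ avgLocalConductance δ f) ∧
    (∀ (σ : ℝ) (K : Set (EuclideanSpace ℝ (Fin n))), 0 < σ → σ ≤ 1 →
      Convex ℝ K → Metric.closedBall 0 1 ⊆ K → δ ≤ σ / (4096 * √(n : ℝ)) →
        1 / 2 ≤ avgLocalConductance δ (restrictedGaussian K σ)) := by
  have hn' : 0 < √(n : ℝ) := Real.sqrt_pos.2 (by exact_mod_cast hn)
  refine ⟨fun a f ha hf hlc hr => ?_, fun σ K hσ hσ1 hK hball hδσ => ?_⟩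
  · refine le_trans ?_ (one_sub_le_avgLocalConductance hn ha hδ hf hlc hr)
    have heq : δ ^ (1 / 2 : ℝ) * (n : ℝ) ^ (1 / 4 : ℝ) / a ^ (1 / 2 : ℝ) = √(δ * √n / a) := by
      rw [Real.sqrt_eq_rpow, Real.sqrt_eq_rpow, Real.div_rpow (by positivity) ha.le,
        Real.mul_rpow hδ.le (by positivity), ← Real.rpow_mul (Nat.cast_nonneg n)]
      norm_num
    rw [heq]
    linarith [Real.sqrt_nonneg (δ * √n / a)]
  · refine le_trans ?_ (one_sub_le_avgLocalConductance hn (half_pos hσ) hδ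
      (isProbDensity_restrictedGaussian hσ hσ1 hK hball)
      (isLogConcave_restrictedGaussian hσ hσ1 hK hball)
      (isRounded_restrictedGaussian hn hσ hσ1 hK hball))
    -- The ratio is at most `2 / 4096`, below `1 / 1600`, and `20 / 40 = 1 / 2`.
    have hsqrt : √(δ * √n / (σ / 2)) ≤ 1 / 40 := by
      rw [Real.sqrt_le_left (by norm_num), div_le_iff₀ (by positivity)]
      rw [le_div_iff₀ (by positivity)] at hδσ
      nlinarith
    linarith
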